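/- A Markov triple is a triple of positive integers $(x,y,z)$ with $x^2+y^2+z^2=3xyz$; a Markov number is an integer that is the largest element of some Markov triple. Markov's uniqueness conjecture states that every Markov triple is determined, up to reordering, by its largest element. A necklace is a class of finite nonempty sequences $[n_1,\dots,n_k]$ of integers up to cyclic shifts. It has small variation if for every $s\ge 0$ and all $i_0,j_0\in\{1,\dots,k\}$ one has $\left|\sum_{i=i_0}^{i_0+s}n_i-\sum_{j=j_0}^{j_0+s}n_j\right|\le 1$, with indices modulo $k$; it is primitive if it is not represented by a power by concatenation of a shorter sequence. Let $\mathcal N$ be the set of primitive necklaces of positive integers with small variation together with the trivial necklace $[0]$. Let $\xi=3+\sqrt5$ and $\overline\xi=3-\sqrt5$. For $S\subseteq\{1,\dots,k\}$ with complement $S^c$, a run of $S$ is a maximal nonempty subset of $S$ consisting of cyclically consecutive numbers. Put $r(S)=\sum_{s}(|s|-1)$, where $s$ ranges over the runs of $S$ and the runs of $S^c$, if $S$ and $S^c$ are both nonempty, and $r(\emptyset)=r(\{1,\dots,k\})=k$. For $[n_1,\dots,n_k]\in\mathcal N$ define $$\Phi([n_1,\dots,n_k])=\frac{1}{10^k\,2^{n_1+\cdots+n_k}}\sum_{S\subseteq\{1,\dots,k\}}3^{r(S)-1}\,2^{k-r(S)}\,(\xi+2)^{|S|}\,(\overline\xi+2)^{|S^c|}\,\xi^{\sum_{i\in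 S}n_i}\;\overline\xi^{\sum_{i\in S^c}n_i}.$$ Theorem. Markov's uniqueness conjecture holds if and only if $\Phi$ is injective on $\mathcal N$. Moreover, the set of Markov numbers is exactly the image $\Phi(\mathcal N)$ (in particular, $\Phi$ takes positive integer values on $\mathcal N$). -/

import Mathlib

open Finset

/-! ### Markov triples, Markov numbers and the uniqueness conjecture -/

/-- A triple of positive integers with `x² + y² + z² = 3xyz`. -/
def IsMarkovTriple (x y z : ℕ) : Prop :=
  0 < x ∧ 0 < y ∧ 0 < z ∧ x ^ 2 + y ^ 2 + z ^ 2 = 3 * x * y * z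

/-- A Markov number is the largest element of a Markov triple. -/
def IsMarkovNumber (z : ℕ) : Prop :=
  ∃ x y : ℕ, IsMarkovTriple x y z ∧ x ≤ z ∧ y ≤ z

/-- Every Markov triple is determined, up to reordering, by its largest element. -/
def MarkovUniquenessConjecture : Prop :=
  ∀ x y x' y' z : ℕ,
    IsMarkovTriple x y z → x ≤ y → y ≤ z →
    IsMarkovTriple x' y' z → x' ≤ y' → y' ≤ z →
    x = x' ∧ y = y'

/-! ### Cyclic runs of subsets of the index set

The index set `{1, …, k}` is `Fin k`; the cyclic successor is `finRotate k`, that is `i ↦ i + 1`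
modulo `k`. -/

/-- A nonempty set of cyclically consecutive indices `a, a + 1, …, a + m` modulo `k`. -/
def IsCyclicInterval {k : ℕ} (s : Finset (Fin k)) : Prop :=
  ∃ (a : Fin k) (m : ℕ), s = (range (m + 1)).image fun t => (finRotate k ^ t) a

open Classical in
/-- The runs of `S`: the maximal subsets of `S` made of cyclically consecutive indices. -/
noncomputable def cyclicRuns {k : ℕ} (S : Finset (Fin k)) : Finset (Finset (Fin k)) :=
  univ.filter fun s => Maximal (fun t => t ⊆ S ∧ IsCyclicInterval t) s

/-- The run statistic: the sum of `|s| - 1` over all runs `s` of `S` and of its complement if `S`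
is neither empty nor everything, and `k` otherwise. -/
noncomputable def runStat {k : ℕ} (S : Finset (Fin k)) : ℤ :=
  if S = ∅ ∨ S = univ then (k : ℤ)
  else ∑ s ∈ cyclicRuns S ∪ cyclicRuns Sᶜ, ((s.card : ℤ) - 1)

/-! ### The function on finite sequences -/

/-- `ξ = 3 + √5`. -/
noncomputable def markovXi : ℝ := 3 + Real.sqrt 5

/-- `ξ̄ = 3 - √5`. -/
noncomputable def markovXiBar : ℝ := 3 - Real.sqrt 5

/-- The explicit expression for a finite sequence `n = (n₁, …, n_k)`. The exponents `r(S) - 1`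
and `k - r(S)` are integers (the first one can be `-1`). -/
noncomputable def phiSeq {k : ℕ} (n : Fin k → ℕ) : ℝ :=
  1 / ((10 : ℝ) ^ k * 2 ^ (∑ i, n i)) *
    ∑ S : Finset (Fin k),
      (3 : ℝ) ^ (runStat S - 1) * (2 : ℝ) ^ ((k : ℤ) - runStat S) *
        (markovXi + 2) ^ S.card * (markovXiBar + 2) ^ Sᶜ.card *
        markovXi ^ (∑ i ∈ S, n i) * markovXiBar ^ (∑ i ∈ Sᶜ, n i)

/-- Small variation: any two cyclic blocks of the same size have sums differing by at most `1`. -/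
def SmallVariationSeq {k : ℕ} (n : Fin k → ℕ) : Prop :=
  ∀ (s : ℕ) (i j : Fin k),
    |(∑ t ∈ range (s + 1), (n ((finRotate k ^ t) i) : ℤ))
      - ∑ t ∈ range (s + 1), (n ((finRotate k ^ t) j) : ℤ)| ≤ 1

/-! ### Invariance under cyclic shifts -/

theorem isCyclicInterval_map_rotate {k : ℕ} (s : Finset (Fin k)) :
    IsCyclicInterval (s.map (finRotate k).toEmbedding) ↔ IsCyclicInterval s := by
  have key : ∀ (a : Fin k) (t : ℕ),
      finRotate k ((finRotate k ^ t) a) = (finRotate k ^ t) (finRotate k a) := by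
    intro a t
    rw [← Equiv.Perm.mul_apply, ← Equiv.Perm.mul_apply, ← pow_succ', ← pow_succ]
  constructor
  · rintro ⟨a, m, h⟩
    refine ⟨(finRotate k).symm a, m, ?_⟩
    apply Finset.map_injective (finRotate k).toEmbedding
    rw [h, Finset.map_eq_image, Finset.image_image]
    apply Finset.image_congr
    intro t _
    simp only [Function.comp_apply, Equiv.coe_toEmbedding, key, Equiv.apply_symm_apply]
  · rintro ⟨a, m, rfl⟩
    refine ⟨finRotate k a, m, ?_⟩
    rw [Finset.map_eq_image, Finset.image_image]
    apply Finset.image_congr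
    intro t _
    simp only [Function.comp_apply, Equiv.coe_toEmbedding, key]

open Classical in
theorem mem_cyclicRuns {k : ℕ} (S s : Finset (Fin k)) :
    s ∈ cyclicRuns S ↔ (s ⊆ S ∧ IsCyclicInterval s) ∧
      ∀ t : Finset (Fin k), t ⊆ S ∧ IsCyclicInterval t → s ⊆ t → t ⊆ s := by
  unfold cyclicRuns
  rw [Finset.mem_filter]
  exact ⟨fun h => ⟨h.2.1, fun t ht hst => h.2.2 ht hst⟩,
    fun h => ⟨Finset.mem_univ _, h.1, fun t ht hst => h.2 t ht hst⟩⟩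

theorem cyclicRuns_map_rotate {k : ℕ} (S : Finset (Fin k)) :
    cyclicRuns (S.map (finRotate k).toEmbedding) =
      (cyclicRuns S).map (finRotate k).finsetCongr.toEmbedding := by
  have surj : ∀ s : Finset (Fin k), ∃ u : Finset (Fin k), s = u.map (finRotate k).toEmbedding := fun s =>
    ⟨(finRotate k).finsetCongr.symm s, ((finRotate k).finsetCongr.apply_symm_apply s).symm⟩
  ext s
  obtain ⟨u, rfl⟩ := surj s
  have e : u.map (finRotate k).toEmbedding ∈
      (cyclicRuns S).map (finRotate k).finsetCongr.toEmbedding ↔ u ∈ cyclicRuns S :=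
    Finset.mem_map' (finRotate k).finsetCongr.toEmbedding
  rw [e, mem_cyclicRuns, mem_cyclicRuns]
  simp only [Finset.map_subset_map, isCyclicInterval_map_rotate]
  refine and_congr_right fun _ => ⟨fun h t ht hut => ?_, fun h t ht hut => ?_⟩
  · have := h (t.map (finRotate k).toEmbedding)
    simp only [Finset.map_subset_map, isCyclicInterval_map_rotate] at this
    exact this ht hut
  · obtain ⟨t, rfl⟩ := surj t
    simp only [Finset.map_subset_map, isCyclicInterval_map_rotate] at ht hut ⊢
    exact h t ht hut

theorem compl_map_rotate {k : ℕ} (S : Finset (Fin k)) :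
    (S.map (finRotate k).toEmbedding)ᶜ = Sᶜ.map (finRotate k).toEmbedding := by
  ext x
  simp only [Finset.mem_compl, Finset.mem_map_equiv]

theorem runStat_map_rotate {k : ℕ} (S : Finset (Fin k)) :
    runStat (S.map (finRotate k).toEmbedding) = runStat S := by
  have h : S.map (finRotate k).toEmbedding = univ ↔ S = univ := by
    rw [← Finset.compl_eq_empty_iff, compl_map_rotate, Finset.map_eq_empty,
      Finset.compl_eq_empty_iff]
  simp only [runStat, Finset.map_eq_empty, h, compl_map_rotate, cyclicRuns_map_rotate,
    ← Finset.map_union, Finset.sum_map]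
  simp [Equiv.finsetCongr]

theorem phiSeq_comp_rotate {k : ℕ} (n : Fin k → ℕ) :
    phiSeq (n ∘ finRotate k) = phiSeq n := by
  unfold phiSeq
  congr 1
  · congr 3
    exact Equiv.sum_comp (finRotate k) n
  · refine Fintype.sum_equiv (finRotate k).finsetCongr _ _ fun S => ?_
    simp only [Equiv.finsetCongr_apply, runStat_map_rotate, compl_map_rotate, Finset.card_map,
      Finset.sum_map, Function.comp_apply, Equiv.coe_toEmbedding]

theorem smallVariationSeq_comp_rotate {k : ℕ} (n : Fin k → ℕ) :
    SmallVariationSeq (n ∘ finRotate k) ↔ SmallVariationSeq n := by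
  have key : ∀ (a : Fin k) (t : ℕ),
      finRotate k ((finRotate k ^ t) a) = (finRotate k ^ t) (finRotate k a) := by
    intro a t
    rw [← Equiv.Perm.mul_apply, ← Equiv.Perm.mul_apply, ← pow_succ', ← pow_succ]
  simp only [SmallVariationSeq, Function.comp_apply, key]
  refine forall_congr' fun s => ⟨fun h i j => ?_, fun h i j => h _ _⟩
  simpa only [Equiv.apply_symm_apply] using h ((finRotate k).symm i) ((finRotate k).symm j)

/-- Anything that depends only on the entries up to one cyclic shift is invariant under rotations
of lists. -/
theorem eq_of_isRotated {α : Type*} (F : ∀ {k : ℕ}, (Fin k → ℕ) → α)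
    (hF : ∀ {k : ℕ} (n : Fin k → ℕ), F (n ∘ finRotate k) = F n)
    {l l' : List ℕ} (h : l ~r l') : F l.get = F l'.get := by
  have cast : ∀ {k k' : ℕ} (e : k = k') (n : Fin k → ℕ) (n' : Fin k' → ℕ),
      (∀ i, n' (Fin.cast e i) = n i) → F n' = F n := by
    rintro k _ rfl n n' hn
    congr 1
    exact funext hn
  have one : ∀ l : List ℕ, F (l.rotate 1).get = F l.get := by
    intro l
    rw [← hF l.get]
    refine cast (by simp) _ _ fun i => ?_
    have hl : l.length ≠ 0 := fun h0 => (Fin.cast h0 i).elim0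
    have : NeZero l.length := ⟨hl⟩
    rw [List.get_rotate]
    simp only [Function.comp_apply]
    congr 1
    ext
    simp [finRotate_apply, Fin.val_add]
  obtain ⟨m, rfl⟩ := h
  induction m with
  | zero => exact congrArg (fun l : List ℕ => F l.get) (List.rotate_zero l).symm
  | succ m ih => rw [← List.rotate_rotate, one, ih]

/-! ### Necklaces

A necklace of natural numbers, i.e. a class of finite sequences up to cyclic shifts, is an element
of `Cycle ℕ`. -/

/-- The necklace `[n₁, …, n_k]` has small variation. -/
def Cycle.SmallVariation (c : Cycle ℕ) : Prop :=
  Quotient.liftOn c (fun l : List ℕ => SmallVariationSeq l.get) fun _ _ h =>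
    eq_of_isRotated (fun n => SmallVariationSeq n)
      (fun n => propext (smallVariationSeq_comp_rotate n)) h

/-- The necklace is not represented by a power by concatenation of a shorter sequence. -/
def Cycle.IsPrimitive (c : Cycle ℕ) : Prop :=
  ¬ ∃ (w : List ℕ) (j : ℕ), w.length < c.length ∧ c = ((List.replicate j w).flatten : Cycle ℕ)

/-- The set `𝒩`: primitive (nonempty) necklaces of positive integers with small variation,
together with the trivial necklace `[0]`. -/
def smallVariationNecklaces : Set (Cycle ℕ) :=
  {c | c ≠ Cycle.nil ∧ (∀ n ∈ c, 0 < n) ∧ c.SmallVariation ∧ c.IsPrimitive} ∪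
    {(([0] : List ℕ) : Cycle ℕ)}

/-- The function `Φ` on necklaces. -/
noncomputable def necklacePhi (c : Cycle ℕ) : ℝ :=
  Quotient.liftOn c (fun l : List ℕ => phiSeq l.get) fun _ _ h =>
    eq_of_isRotated (fun n => phiSeq n) (fun n => phiSeq_comp_rotate n) h

/-!
Let `T = [[3, 2], [2, 3]]` and let `D_n` be the diagonal matrix with entries
`(ξ + 2) ξⁿ / (10 · 2ⁿ)` and its conjugate. For a proper nonempty subset `S` the number `r(S)` is
the number of cyclically adjacent pairs of indices lying on the same side of `S`, and the convention
for the two trivial subsets extends this description (`runStat_eq_card`). So the summand of `Φ` at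
`S` is the weight of a closed walk through the indices of a `2 × 2` matrix product, and `3 Φ` is the
trace of `∏ D_{n_i} T` (`phiSeq_eq_trace`). The letter matrices `D_n T = Eⁿ D_0 T` have determinant
`1`; they play the role of the Cohn matrices.

The necklaces of `𝒩` other than `[0]` are parametrized by the reduced fractions `p / q ≥ 1`:
small variation forces every block sum to be less than `1` away from its average, so after rotating
to the place where the partial sums are highest above the line of slope `p / q`, the partial sums are
`⌊i p / q⌋` (`isRotated_mechanicalWord`), and primitivity means that `p` and `q` are coprime
(`mem_smallVariationNecklaces_iff`).

The fractions `> 1` are the mediants at the nodes of the Stern–Brocot tree below `(1 / 1, 1 / 0)`,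
each at exactly one node. The word of a mediant is the concatenation of the words of the two Farey
neighbours (`mechanicalWord_mediant`), so the identity
`tr (X (X Y)) = tr X · tr (X Y) - det X · tr Y` turns a step down the Stern–Brocot tree into the
mutation `(x, y, z) ↦ (x, z, 3xz - y)` of Markov triples, starting at `(2, 1, 5)`: the value of `Φ`
at a node is the largest element of the Markov triple at that node (`necklacePhi_nodeNecklace`).
By the classical descent every Markov triple with largest element at least `5` occurs in the tree
(`exists_markovTriple_eq`), and at only one node (`eq_of_markovTriple_eq`). The necklaces `[0]`, `[1]`
account for the triples `(1, 1, 1)` and `(1, 1, 2)`. Hence the image of `Φ` is the set of Markov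
numbers, and both the injectivity of `Φ` and the uniqueness conjecture say that the largest elements
of the triples at distinct nodes are distinct.
-/

open Finset

/-! ### Runs of a subset and agreement of cyclic neighbours -/

theorem finRotate_pow_val {k : ℕ} (a : Fin k) (t : ℕ) :
    ((finRotate k ^ t) a : ℕ) = (a + t) % k := by
  obtain _ | k := k
  · exact a.elim0
  induction t with
  | zero => simp [Nat.mod_eq_of_lt a.2]
  | succ t ih =>
    rw [pow_succ', Equiv.Perm.mul_apply, finRotate_apply, Fin.val_add, ih]
    simp [Nat.add_assoc]

theorem exists_finRotate_pow {k : ℕ} (a b : Fin k) : ∃ t, (finRotate k ^ t) a = b := by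
  refine ⟨b + k - a, Fin.ext ?_⟩
  rw [finRotate_pow_val, show (a : ℕ) + (b + k - a) = b + k by have := a.2; omega,
    Nat.add_mod_right, Nat.mod_eq_of_lt b.2]

theorem finRotate_pow_succ_apply {k : ℕ} (a : Fin k) (t : ℕ) :
    (finRotate k ^ (t + 1)) a = finRotate k ((finRotate k ^ t) a) := by
  rw [pow_succ', Equiv.Perm.mul_apply]

/-- The cyclic interval `a, a + 1, …, a + m`. -/
def cyclicArc {k : ℕ} (a : Fin k) (m : ℕ) : Finset (Fin k) :=
  (range (m + 1)).image fun t => (finRotate k ^ t) a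

theorem mem_cyclicArc {k : ℕ} {a x : Fin k} {m : ℕ} :
    x ∈ cyclicArc a m ↔ ∃ t ≤ m, (finRotate k ^ t) a = x := by
  simp [cyclicArc]

theorem cyclicArc_union_of_le {k : ℕ} (a : Fin k) {j m : ℕ} (l : ℕ) (hj : j ≤ m) :
    cyclicArc a m ∪ cyclicArc ((finRotate k ^ j) a) l = cyclicArc a (max m (j + l)) := by
  ext x
  simp only [mem_union, mem_cyclicArc, ← Equiv.Perm.mul_apply, ← pow_add]
  constructor
  · rintro (⟨t, ht, rfl⟩ | ⟨t, ht, rfl⟩)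
    · exact ⟨t, by omega, rfl⟩
    · exact ⟨t + j, by omega, rfl⟩
  · rintro ⟨t, ht, rfl⟩
    by_cases h : t ≤ m
    · exact Or.inl ⟨t, h, rfl⟩
    · exact Or.inr ⟨t - j, by omega, by rw [Nat.sub_add_cancel (by omega)]⟩

theorem IsCyclicInterval.union {k : ℕ} {s t : Finset (Fin k)} (hs : IsCyclicInterval s)
    (ht : IsCyclicInterval t) {x : Fin k} (hxs : x ∈ s) (hxt : x ∈ t) :
    IsCyclicInterval (s ∪ t) := by
  obtain ⟨a, m, rfl⟩ := hs
  obtain ⟨b, l, rfl⟩ := ht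
  change x ∈ cyclicArc a m at hxs
  change x ∈ cyclicArc b l at hxt
  change IsCyclicInterval (cyclicArc a m ∪ cyclicArc b l)
  obtain ⟨u, hu, hux⟩ := mem_cyclicArc.1 hxs
  obtain ⟨v, hv, hvx⟩ := mem_cyclicArc.1 hxt
  have key : ∀ {a b : Fin k} {u v : ℕ}, v ≤ u → (finRotate k ^ u) a = (finRotate k ^ v) b →
      (finRotate k ^ (u - v)) a = b := by
    intro a b u v h e
    apply (finRotate k ^ v).injective
    rw [← e, ← Equiv.Perm.mul_apply, ← pow_add, Nat.add_sub_cancel' h]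
  rcases le_total v u with h | h
  · rw [← key h (hux.trans hvx.symm), cyclicArc_union_of_le _ _ (by omega)]
    exact ⟨_, _, rfl⟩
  · rw [← key h (hvx.trans hux.symm), union_comm, cyclicArc_union_of_le _ _ (by omega)]
    exact ⟨_, _, rfl⟩

theorem IsCyclicInterval.nonempty {k : ℕ} {s : Finset (Fin k)} (hs : IsCyclicInterval s) :
    s.Nonempty := by
  obtain ⟨a, m, rfl⟩ := hs
  exact ⟨a, mem_cyclicArc.2 ⟨0, Nat.zero_le _, rfl⟩⟩

theorem exists_mem_cyclicRuns {k : ℕ} {S : Finset (Fin k)} {x : Fin k} (hx : x ∈ S) :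
    ∃ s ∈ cyclicRuns S, x ∈ s := by
  have h0 : ({x} : Finset (Fin k)) ∈ {t | t ⊆ S ∧ IsCyclicInterval t} :=
    ⟨by simpa using hx, x, 0, by simp⟩
  obtain ⟨s, hs, hmax⟩ := (Set.toFinite {t | t ⊆ S ∧ IsCyclicInterval t}).exists_le_maximal h0
  exact ⟨s, (mem_cyclicRuns S s).2 ⟨hmax.1, fun t ht hst => hmax.2 ht hst⟩, by simpa using hs⟩

theorem eq_of_mem_cyclicRuns {k : ℕ} {S s t : Finset (Fin k)} {x : Fin k}
    (hs : s ∈ cyclicRuns S) (ht : t ∈ cyclicRuns S) (hxs : x ∈ s) (hxt : x ∈ t) : s = t := by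
  rw [mem_cyclicRuns] at hs ht
  have hu : s ∪ t ⊆ S ∧ IsCyclicInterval (s ∪ t) :=
    ⟨union_subset hs.1.1 ht.1.1, hs.1.2.union ht.1.2 hxs hxt⟩
  exact (subset_union_left.trans (ht.2 _ hu subset_union_right)).antisymm
    (subset_union_right.trans (hs.2 _ hu subset_union_left))

/-- A run of a proper subset is left only at its last element. -/
theorem exists_filter_finRotate_notMem_eq_singleton {k : ℕ} {S s : Finset (Fin k)}
    (hS : S ≠ univ) (hs : s ∈ cyclicRuns S) :
    ∃ e, s.filter (fun i => finRotate k i ∉ S) = {e} := by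
  rw [mem_cyclicRuns] at hs
  obtain ⟨⟨hsS, a, m, rfl⟩, hmax⟩ := hs
  change cyclicArc a m ⊆ S at hsS
  change ∀ t, t ⊆ S ∧ IsCyclicInterval t → cyclicArc a m ⊆ t → t ⊆ cyclicArc a m at hmax
  change ∃ e, (cyclicArc a m).filter _ = {e}
  have hend : (finRotate k ^ (m + 1)) a ∉ S := by
    intro hmem
    have hsub : cyclicArc a (m + 1) ⊆ cyclicArc a m := by
      refine hmax _ ⟨fun x hx => ?_, a, m + 1, rfl⟩ fun x hx => ?_
      · obtain ⟨t, ht, rfl⟩ := mem_cyclicArc.1 hx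
        rcases ht.lt_or_eq with h | rfl
        · exact hsS (mem_cyclicArc.2 ⟨t, by omega, rfl⟩)
        · exact hmem
      · obtain ⟨t, ht, rfl⟩ := mem_cyclicArc.1 hx
        exact mem_cyclicArc.2 ⟨t, by omega, rfl⟩
    -- The arc would be closed under the cyclic successor, hence everything.
    have hall : ∀ t, (finRotate k ^ t) a ∈ cyclicArc a m := by
      intro t
      induction t with
      | zero => exact mem_cyclicArc.2 ⟨0, by omega, rfl⟩
      | succ t ih =>
        obtain ⟨u, hu, e⟩ := mem_cyclicArc.1 ih
        rw [finRotate_pow_succ_apply, ← e, ← finRotate_pow_succ_apply]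
        exact hsub (mem_cyclicArc.2 ⟨u + 1, by omega, rfl⟩)
    refine hS (eq_univ_iff_forall.2 fun x => ?_)
    obtain ⟨t, rfl⟩ := exists_finRotate_pow a x
    exact hsS (hall t)
  refine ⟨(finRotate k ^ m) a, ?_⟩
  ext x
  rw [mem_filter, mem_singleton]
  constructor
  · rintro ⟨hx, hxS⟩
    obtain ⟨t, ht, rfl⟩ := mem_cyclicArc.1 hx
    rcases ht.lt_or_eq with h | rfl
    · refine absurd (hsS (mem_cyclicArc.2 ⟨t + 1, h, ?_⟩)) hxS
      exact finRotate_pow_succ_apply a t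
    · rfl
  · rintro rfl
    exact ⟨mem_cyclicArc.2 ⟨m, le_rfl, rfl⟩, by rwa [← finRotate_pow_succ_apply]⟩

theorem sum_cyclicRuns_card_sub_one {k : ℕ} {S : Finset (Fin k)} (hS : S ≠ univ) :
    ∑ s ∈ cyclicRuns S, ((s.card : ℤ) - 1) =
      ((S.filter fun i => finRotate k i ∈ S).card : ℤ) := by
  have hU : S.filter (fun i => finRotate k i ∈ S) =
      (cyclicRuns S).biUnion fun s => s.filter fun i => finRotate k i ∈ S := by
    ext x
    simp only [mem_filter, mem_biUnion]
    constructor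
    · rintro ⟨hx, hx'⟩
      obtain ⟨s, hs, hxs⟩ := exists_mem_cyclicRuns hx
      exact ⟨s, hs, hxs, hx'⟩
    · rintro ⟨s, hs, hxs, hx'⟩
      exact ⟨((mem_cyclicRuns S s).1 hs).1.1 hxs, hx'⟩
  rw [hU, card_biUnion, Nat.cast_sum]
  · refine sum_congr rfl fun s hs => ?_
    obtain ⟨e, he⟩ := exists_filter_finRotate_notMem_eq_singleton hS hs
    have h := card_filter_add_card_filter_not (s := s) (fun i => finRotate k i ∈ S)
    rw [he, card_singleton] at h
    omega
  · intro s hs t ht hst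
    refine disjoint_left.2 fun x hxs hxt => hst ?_
    exact eq_of_mem_cyclicRuns hs ht (mem_filter.1 hxs).1 (mem_filter.1 hxt).1

/-- The run statistic counts the cyclic neighbours lying on the same side of `S`. This also explains
the convention `r(∅) = r(univ) = k`. -/
theorem runStat_eq_card {k : ℕ} (S : Finset (Fin k)) :
    runStat S = ((univ.filter fun i => (i ∈ S ↔ finRotate k i ∈ S)).card : ℤ) := by
  unfold runStat
  split_ifs with h
  · rcases h with rfl | rfl <;> simp
  · push Not at h
    have hc : Sᶜ ≠ univ := fun e => h.1.ne_empty (by simpa using e)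
    rw [sum_union, sum_cyclicRuns_card_sub_one h.2, sum_cyclicRuns_card_sub_one hc,
      ← Nat.cast_add, ← card_union_of_disjoint]
    · congr 2
      ext x
      simp only [mem_union, mem_filter, mem_compl, mem_univ, true_and]
      tauto
    · refine disjoint_left.2 fun x hx hx' => ?_
      exact mem_compl.1 (mem_filter.1 hx').1 (mem_filter.1 hx).1
    · refine disjoint_left.2 fun s hs hs' => ?_
      rw [mem_cyclicRuns] at hs hs'
      obtain ⟨x, hx⟩ := hs.1.2.nonempty
      exact mem_compl.1 (hs'.1.1 hx) (hs.1.1 hx)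

/-! ### The explicit expression as a trace of a matrix product -/

theorem List.prod_ofFn_apply_eq_sum {R ι : Type*} [CommRing R] [Fintype ι] [DecidableEq ι]
    {k : ℕ} (M : Fin k → Matrix ι ι R) (a b : ι) :
    (List.ofFn M).prod a b = ∑ f : Fin (k + 1) → ι,
      if f 0 = a ∧ f (Fin.last k) = b then ∏ i, M i (f i.castSucc) (f i.succ) else 0 := by
  induction k generalizing a with
  | zero =>
    rw [← (Equiv.funUnique (Fin 1) ι).symm.sum_comp]
    simp [Matrix.one_apply, ite_and]
  | succ k ih =>
    rw [List.ofFn_succ, List.prod_cons, Matrix.mul_apply]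
    simp_rw [ih]
    rw [← (Fin.consEquiv (fun _ => ι)).sum_comp, Fintype.sum_prod_type]
    simp only [Fin.consEquiv_apply, Fin.cons_zero, ← Fin.succ_last, Fin.cons_succ,
      Fin.prod_univ_succ, Fin.castSucc_zero, ← Fin.succ_castSucc]
    simp only [ite_and, Finset.sum_ite_irrel, Finset.sum_ite_eq', Finset.sum_const_zero,
      Finset.mem_univ, if_true]
    simp_rw [Finset.mul_sum, mul_ite, mul_zero]
    rw [Finset.sum_comm]
    simp

/-- The trace of a product is the sum of the weights of the closed walks through the indices. -/
theorem Matrix.trace_prod_ofFn {R ι : Type*} [CommRing R] [Fintype ι] [DecidableEq ι]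
    {k : ℕ} (hk : k ≠ 0) (M : Fin k → Matrix ι ι R) :
    (List.ofFn M).prod.trace = ∑ f : Fin k → ι, ∏ i, M i (f i) (f (finRotate k i)) := by
  obtain ⟨k, rfl⟩ := Nat.exists_eq_succ_of_ne_zero hk
  have hlist : List.ofFn M = (List.ofFn fun i : Fin k => M i.castSucc) ++ [M (Fin.last k)] := by
    rw [List.ofFn_succ_last]
  rw [hlist, List.prod_append, List.prod_singleton, Matrix.trace]
  simp_rw [Matrix.diag_apply, Matrix.mul_apply, List.prod_ofFn_apply_eq_sum, Finset.sum_mul]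
  simp_rw [Fin.prod_univ_castSucc]
  rw [Finset.sum_congr rfl fun a _ => Finset.sum_comm, Finset.sum_comm]
  refine Finset.sum_congr rfl fun f _ => ?_
  simp [ite_and, ite_mul, Finset.sum_ite_eq]

/-- The matrix attached to the letter `n`. -/
noncomputable def letterMatrix (n : ℕ) : Matrix (Fin 2) (Fin 2) ℝ :=
  Matrix.of fun a b =>
    (if a = 0 then (markovXi + 2) * markovXi ^ n else (markovXiBar + 2) * markovXiBar ^ n) /
      (10 * 2 ^ n) * if a = b then 3 else 2

/-- Subsets as indicator functions, members being sent to `0`. -/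
def finsetEquivFinTwo (k : ℕ) : Finset (Fin k) ≃ (Fin k → Fin 2) where
  toFun S i := if i ∈ S then 0 else 1
  invFun f := univ.filter fun i => f i = 0
  left_inv S := by ext i; simp
  right_inv f := by
    funext i
    simp only [mem_filter, mem_univ, true_and]
    split_ifs <;> omega

theorem phiSeq_eq_trace {k : ℕ} (hk : k ≠ 0) (n : Fin k → ℕ) :
    phiSeq n = (List.ofFn fun i => letterMatrix (n i)).prod.trace / 3 := by
  rw [Matrix.trace_prod_ofFn hk, phiSeq, mul_sum, sum_div]
  refine Fintype.sum_equiv (finsetEquivFinTwo k) _ _ fun S => ?_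
  have h1 : ∀ i, letterMatrix (n i) (finsetEquivFinTwo k S i)
      (finsetEquivFinTwo k S (finRotate k i)) =
      ((if i ∈ S then (markovXi + 2) * markovXi ^ n i else
          (markovXiBar + 2) * markovXiBar ^ n i) / (10 * 2 ^ n i)) *
        if (i ∈ S ↔ finRotate k i ∈ S) then 3 else 2 := by
    intro i
    simp only [letterMatrix, finsetEquivFinTwo, Equiv.coe_fn_mk, Matrix.of_apply]
    by_cases h : i ∈ S <;> by_cases h' : finRotate k i ∈ S <;> simp [h]
  simp_rw [h1]
  have hcard := card_filter_add_card_filter_not (s := (univ : Finset (Fin k)))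
    (fun i => (i ∈ S ↔ finRotate k i ∈ S))
  have hfS : univ.filter (fun i => i ∈ S) = S := by ext; simp
  have hfC : univ.filter (fun i => i ∉ S) = Sᶜ := by ext; simp
  rw [prod_mul_distrib, prod_div_distrib, prod_mul_distrib, prod_ite, prod_ite, prod_mul_distrib,
    prod_mul_distrib, hfS, hfC, runStat_eq_card]
  simp only [prod_const, prod_pow_eq_pow_sum, card_univ, Fintype.card_fin] at hcard ⊢
  set r := (univ.filter fun i => (i ∈ S ↔ finRotate k i ∈ S)).card
  set r' := (univ.filter fun i => ¬ (i ∈ S ↔ finRotate k i ∈ S)).card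
  have h2 : (k : ℤ) - r = (r' : ℤ) := by omega
  rw [h2, zpow_sub_one₀ (by norm_num), zpow_natCast, zpow_natCast]
  ring

/-! ### Small variation necklaces are the mechanical words -/

/-- The word of length `q` and sum `p` formed by the successive differences of `⌊i p / q⌋`. -/
def mechanicalWord (p q : ℕ) : List ℕ :=
  (List.range q).map fun i => (i + 1) * p / q - i * p / q

@[simp] theorem mechanicalWord_length (p q : ℕ) : (mechanicalWord p q).length = q := by
  simp [mechanicalWord]

theorem sum_range_map_div_sub (p q k : ℕ) :
    ((List.range k).map fun i => (i + 1) * p / q - i * p / q).sum = k * p / q := by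
  induction k with
  | zero => simp
  | succ k ih =>
    rw [List.range_succ, List.map_append, List.sum_append, ih]
    have : k * p / q ≤ (k + 1) * p / q := Nat.div_le_div_right (Nat.mul_le_mul_right _ (by omega))
    simp only [List.map_cons, List.map_nil, List.sum_cons, List.sum_nil]
    omega

theorem mechanicalWord_sum (p : ℕ) {q : ℕ} (hq : 0 < q) : (mechanicalWord p q).sum = p := by
  rw [mechanicalWord, sum_range_map_div_sub, Nat.mul_div_cancel_left _ hq]

theorem pos_of_mem_mechanicalWord {p q n : ℕ} (hq : 0 < q) (h : q ≤ p)
    (hn : n ∈ mechanicalWord p q) : 0 < n := by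
  simp only [mechanicalWord, List.mem_map, List.mem_range] at hn
  obtain ⟨i, -, rfl⟩ := hn
  have h1 : (i * p + q) / q = i * p / q + 1 := Nat.add_div_right _ hq
  have h2 : (i * p + q) / q ≤ (i + 1) * p / q := Nat.div_le_div_right (by linarith)
  omega

theorem mechanicalWord_mul_mul {d p q : ℕ} (hd : 0 < d) (hq : 0 < q) :
    mechanicalWord (d * p) (d * q) = (List.replicate d (mechanicalWord p q)).flatten := by
  have h : ∀ e, (List.range (e * q)).map (fun i => (i + 1) * p / q - i * p / q) =
      (List.replicate e (mechanicalWord p q)).flatten := by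
    intro e
    induction e with
    | zero => simp
    | succ e ih =>
      rw [Nat.succ_mul, List.range_add, List.map_append, ih, List.replicate_succ',
        List.flatten_append, List.map_map]
      congr 1
      simp only [List.flatten_cons, List.flatten_nil, List.append_nil, mechanicalWord]
      refine List.map_congr_left fun i _ => ?_
      have h1 : (e * q + i + 1) * p = (i + 1) * p + q * (e * p) := by ring
      have h2 : (e * q + i) * p = i * p + q * (e * p) := by ring
      simp only [Function.comp_apply, h1, h2, Nat.add_mul_div_left _ _ hq]
      omega
  rw [← h, mechanicalWord]
  refine List.map_congr_left fun i _ => ?_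
  rw [Nat.mul_left_comm, Nat.mul_left_comm i, Nat.mul_div_mul_left _ _ hd,
    Nat.mul_div_mul_left _ _ hd]

/-- The periodic extension of a word. -/
def periodicExt (l : List ℕ) (t : ℕ) : ℕ := l.getD (t % l.length) 0

theorem periodicExt_add_length (l : List ℕ) (t : ℕ) :
    periodicExt l (t + l.length) = periodicExt l t := by
  simp [periodicExt]

theorem get_finRotate_pow (l : List ℕ) (i : Fin l.length) (t : ℕ) :
    l.get ((finRotate l.length ^ t) i) = periodicExt l (i + t) := by
  have h : (i + t : ℕ) % l.length < l.length := Nat.mod_lt _ i.pos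
  rw [periodicExt, List.getD_eq_getElem _ _ h, List.get_eq_getElem]
  congr 1
  exact finRotate_pow_val i t

theorem smallVariationSeq_iff (l : List ℕ) :
    SmallVariationSeq l.get ↔ ∀ s i j, i < l.length → j < l.length →
      |(∑ t ∈ range (s + 1), (periodicExt l (i + t) : ℤ)) -
        ∑ t ∈ range (s + 1), (periodicExt l (j + t) : ℤ)| ≤ 1 := by
  simp only [SmallVariationSeq, get_finRotate_pow]
  exact ⟨fun h s i j hi hj => h s ⟨i, hi⟩ ⟨j, hj⟩, fun h s i j => h s i j i.2 j.2⟩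

theorem periodicExt_mechanicalWord (p : ℕ) {q : ℕ} (hq : 0 < q) (t : ℕ) :
    (periodicExt (mechanicalWord p q) t : ℤ) = ((t + 1) * p / q : ℕ) - (t * p / q : ℕ) := by
  have ht : t % q < q := Nat.mod_lt _ hq
  have hle : ∀ i, i * p / q ≤ (i + 1) * p / q := fun i =>
    Nat.div_le_div_right (Nat.mul_le_mul_right _ (by omega))
  rw [periodicExt, mechanicalWord_length, List.getD_eq_getElem _ _ (by simpa using ht)]
  simp only [mechanicalWord, List.getElem_map, List.getElem_range]
  rw [Nat.cast_sub (hle _)]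
  have h1 : (t + 1) * p = (t % q + 1) * p + q * (t / q * p) := by
    conv_lhs => rw [← Nat.mod_add_div t q]
    ring
  have h2 : t * p = t % q * p + q * (t / q * p) := by
    conv_lhs => rw [← Nat.mod_add_div t q]
    ring
  rw [h1, h2, Nat.add_mul_div_left _ _ hq, Nat.add_mul_div_left _ _ hq]
  push_cast
  ring

theorem smallVariationSeq_mechanicalWord (p : ℕ) {q : ℕ} (hq : 0 < q) :
    SmallVariationSeq (mechanicalWord p q).get := by
  rw [smallVariationSeq_iff]
  have hsum : ∀ i s, (∑ t ∈ range s, (periodicExt (mechanicalWord p q) (i + t) : ℤ)) =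
      ((i + s) * p / q : ℕ) - (i * p / q : ℕ) := by
    intro i s
    simp only [periodicExt_mechanicalWord p hq]
    exact sum_range_sub (fun t => (((i + t) * p / q : ℕ) : ℤ)) s
  -- Each block of length `s` has sum `⌊s p / q⌋` or `⌊s p / q⌋ + 1`.
  have hb : ∀ i s, i * p / q + s * p / q ≤ (i + s) * p / q ∧
      (i + s) * p / q ≤ i * p / q + s * p / q + 1 := by
    intro i s
    rw [add_mul, Nat.add_div hq]
    split_ifs <;> omega
  intro s i j _ _
  rw [hsum, hsum, abs_le]
  have := hb i (s + 1)
  have := hb j (s + 1)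
  omega

theorem sum_range_periodicExt (l : List ℕ) (s : ℕ) :
    ∑ u ∈ range l.length, periodicExt l (u + s) = l.sum := by
  induction s with
  | zero =>
    conv_rhs => rw [← List.ofFn_get l, List.sum_ofFn]
    rw [Finset.sum_range]
    refine sum_congr rfl fun u _ => ?_
    simp [periodicExt, Nat.mod_eq_of_lt u.2]
  | succ s ih =>
    rw [← ih]
    have h := sum_range_succ (fun u => periodicExt l (u + s)) l.length
    rw [sum_range_succ', add_comm l.length, periodicExt_add_length, zero_add] at h
    have h' := add_right_cancel h
    simpa only [add_right_comm, add_assoc, add_comm 1] using h'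

/-- In a word of small variation, every block of length `s` has sum less than `1` away from the
average: `l.length` times the difference is a sum of `l.length` differences of blocks, all at most
`1` in absolute value and one of them zero. -/
theorem abs_length_mul_block_sub_lt {l : List ℕ} (hl : SmallVariationSeq l.get) (s : ℕ) {i : ℕ}
    (hi : i < l.length) :
    |(l.length : ℤ) * (∑ t ∈ range s, (periodicExt l (i + t) : ℤ)) - s * l.sum| < l.length := by
  rcases s with _ | s
  · simp; omega
  rw [smallVariationSeq_iff] at hl
  set B : ℕ → ℤ := fun i => ∑ t ∈ range (s + 1), (periodicExt l (i + t) : ℤ) with hB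
  have hsum : ∑ j ∈ range l.length, B j = ((s + 1 : ℕ) : ℤ) * l.sum := by
    rw [hB, sum_comm]
    simp only [← Nat.cast_sum, sum_range_periodicExt]
    simp
  have h1 : (l.length : ℤ) * B i - ((s + 1 : ℕ) : ℤ) * l.sum =
      ∑ j ∈ (range l.length).erase i, (B i - B j) := by
    rw [sum_erase _ (sub_self _), sum_sub_distrib, hsum]
    simp
  rw [h1]
  calc |∑ j ∈ (range l.length).erase i, (B i - B j)|
      ≤ ∑ j ∈ (range l.length).erase i, |B i - B j| := abs_sum_le_sum_abs _ _
    _ ≤ ∑ j ∈ (range l.length).erase i, 1 :=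
        sum_le_sum fun j hj => hl s i j hi (mem_range.1 (mem_of_mem_erase hj))
    _ < l.length := by
        rw [sum_const, card_erase_of_mem (mem_range.2 hi), card_range, nsmul_one]
        omega

/-- A word of small variation is, up to rotation, the mechanical word of its slope. The rotation
starts where the graph of the partial sums is highest above the line of average slope. -/
theorem isRotated_mechanicalWord {l : List ℕ} (hne : l ≠ []) (hl : SmallVariationSeq l.get) :
    l ~r mechanicalWord l.sum l.length := by
  have hk : 0 < l.length := List.length_pos_iff.2 hne
  set P : ℕ → ℤ := fun t => ∑ j ∈ range t, (periodicExt l j : ℤ) with hP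
  set f : ℕ → ℤ := fun t => l.length * P t - t * l.sum with hf
  have hPadd : ∀ i s, P (i + s) = P i + ∑ t ∈ range s, (periodicExt l (i + t) : ℤ) := by
    intro i s
    exact sum_range_add _ _ _
  have hper : ∀ t, f (t + l.length) = f t := by
    intro t
    have h := sum_range_periodicExt l t
    simp only [hf, hPadd t]
    have h2 : (∑ u ∈ range l.length, (periodicExt l (t + u) : ℤ)) = l.sum := by
      rw [← h]; push_cast
      exact sum_congr rfl fun u _ => by rw [add_comm]
    rw [h2]; push_cast; ring
  have hmod : ∀ t, f t = f (t % l.length) := by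
    have : Function.Periodic f l.length := hper
    exact fun t => (this.map_mod_nat t).symm
  obtain ⟨i, hi, hmax⟩ := exists_max_image (range l.length) f ⟨0, mem_range.2 hk⟩
  rw [mem_range] at hi
  have hmax' : ∀ t, f t ≤ f i := fun t => by
    rw [hmod t]; exact hmax _ (mem_range.2 (Nat.mod_lt _ hk))
  have hQ : ∀ t, (∑ u ∈ range t, (periodicExt l (i + u) : ℤ)) = (t * l.sum / l.length : ℕ) := by
    intro t
    have h1 := abs_lt.1 (abs_length_mul_block_sub_lt hl t hi)
    have h2 := hmax' (i + t)
    simp only [hf, hPadd i t] at h2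
    generalize l.sum = S at h1 h2 ⊢
    push_cast at h2 ⊢
    symm
    rw [Int.ediv_eq_iff_of_pos (by exact_mod_cast hk)]
    constructor <;> nlinarith [h1.1, h1.2, h2]
  refine ⟨i, List.ext_getElem (by simp) fun j hj hj' => ?_⟩
  rw [List.length_rotate] at hj
  have h3 : ((l.rotate i)[j]'(by simpa using hj)) = periodicExt l (i + j) := by
    rw [List.getElem_rotate, periodicExt, List.getD_eq_getElem _ _ (Nat.mod_lt _ hk)]
    congr 2
    omega
  rw [h3]
  have h4 := hQ (j + 1)
  rw [sum_range_succ, hQ j] at h4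
  simp only [mechanicalWord, List.getElem_map, List.getElem_range]
  omega

theorem cycle_length_eq {l l' : List ℕ} (h : (l : Cycle ℕ) = l') :
    l.length = l'.length ∧ l.sum = l'.sum :=
  have h' := (Cycle.coe_eq_coe.1 h).perm
  ⟨h'.length_eq, h'.sum_eq⟩

theorem mechanicalWord_isPrimitive {p q : ℕ} (hq : 0 < q) (hpq : p.Coprime q) :
    ((mechanicalWord p q : List ℕ) : Cycle ℕ).IsPrimitive := by
  rintro ⟨w, j, hw, h⟩
  obtain ⟨h1, h2⟩ := cycle_length_eq h
  rw [mechanicalWord_sum p hq] at h2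
  simp only [mechanicalWord_length, List.length_flatten, List.sum_flatten, List.map_replicate,
    List.sum_replicate, smul_eq_mul, Cycle.length_coe] at h1 h2 hw
  have hj : j = 1 := Nat.dvd_one.1 (hpq ▸ Nat.dvd_gcd ⟨_, h2⟩ ⟨_, h1⟩)
  rw [hj] at h1
  omega

/-- The necklaces of small variation are the mechanical words of the reduced fractions `p / q ≥ 1`,
and the trivial one. -/
theorem mem_smallVariationNecklaces_iff (c : Cycle ℕ) :
    c ∈ smallVariationNecklaces ↔ c = (([0] : List ℕ) : Cycle ℕ) ∨
      ∃ p q : ℕ, 0 < q ∧ q ≤ p ∧ p.Coprime q ∧ c = (mechanicalWord p q : List ℕ) := by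
  rw [smallVariationNecklaces, Set.mem_union, Set.mem_singleton_iff, or_comm, Set.mem_ofPred_eq]
  refine or_congr Iff.rfl ⟨?_, ?_⟩
  · rintro ⟨hnil, hpos, hsv, hprim⟩
    induction c using Quotient.inductionOn with | _ l => ?_
    change (l : Cycle ℕ) ≠ Cycle.nil at hnil
    change ∀ n ∈ (l : Cycle ℕ), 0 < n at hpos
    change SmallVariationSeq l.get at hsv
    change (l : Cycle ℕ).IsPrimitive at hprim
    change ∃ p q : ℕ, 0 < q ∧ q ≤ p ∧ p.Coprime q ∧ (l : Cycle ℕ) = (mechanicalWord p q : List ℕ)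
    have hne : l ≠ [] := fun h => hnil (by rw [h]; rfl)
    have hk : 0 < l.length := List.length_pos_iff.2 hne
    have hrot := isRotated_mechanicalWord hne hsv
    refine ⟨l.sum, l.length, hk, ?_, ?_, Cycle.coe_eq_coe.2 hrot⟩
    · have := List.card_nsmul_le_sum l 1 fun n hn => hpos n hn
      simpa using this
    · by_contra hcop
      set d := l.sum.gcd l.length with hd
      have hd0 : 0 < d := Nat.gcd_pos_of_pos_right _ hk
      have hd1 : d ≠ 1 := hcop
      obtain ⟨p, hp⟩ := Nat.gcd_dvd_left l.sum l.length
      obtain ⟨q, hq⟩ := Nat.gcd_dvd_right l.sum l.length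
      rw [← hd] at hp hq
      have hq0 : 0 < q := Nat.pos_of_ne_zero fun h => by simp [h] at hq; exact hne hq
      refine hprim ⟨mechanicalWord p q, d, ?_, ?_⟩
      · rw [mechanicalWord_length, Cycle.length_coe, hq]
        nlinarith [show 2 ≤ d by omega]
      · rw [Cycle.coe_eq_coe, ← mechanicalWord_mul_mul hd0 hq0, ← hp, ← hq]
        exact hrot
  · rintro ⟨p, q, hq, hqp, hcop, rfl⟩
    refine ⟨fun h => ?_, fun n hn => pos_of_mem_mechanicalWord hq hqp hn,
      smallVariationSeq_mechanicalWord p hq, mechanicalWord_isPrimitive hq hcop⟩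
    have := (cycle_length_eq (l' := []) h).1
    simp at this
    omega

/-! ### Factorization of mechanical words and their matrices -/

/-- The standard factorization: the word of the mediant of two Farey neighbours is the
concatenation of the words of the neighbours. -/
theorem mechanicalWord_mediant {p q p' q' : ℕ} (hq : 0 < q) (hq' : 0 < q')
    (h : p' * q = p * q' + 1) :
    mechanicalWord (p + p') (q + q') = mechanicalWord p q ++ mechanicalWord p' q' := by
  have h1 : ∀ i ≤ q, i * (p + p') / (q + q') = i * p / q := by
    intro i hi
    have hd := Nat.div_add_mod (i * p) q
    have hr := Nat.mod_lt (i * p) hq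
    set a := i * p / q
    set r := i * p % q
    have key : q * (i * (p + p')) = q * (a * (q + q')) + (r * (q + q') + i) := by
      zify at h hd ⊢
      linear_combination (-(q + q') : ℤ) * hd + i * h
    have hr' : r * (q + q') + (q + q') ≤ q * (q + q') := by nlinarith
    refine Nat.div_eq_of_lt_le (le_of_mul_le_mul_left (a := q) ?_ hq)
      (lt_of_mul_lt_mul_left (a := q) ?_ hq.le)
    · omega
    · rw [key, add_mul a, one_mul, mul_add q (a * (q + q'))]; omega
  have h2 : ∀ j ≤ q', (q + j) * (p + p') / (q + q') = p + j * p' / q' := by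
    intro j hj
    have hd := Nat.div_add_mod (j * p') q'
    have hr := Nat.mod_lt (j * p') hq'
    set a := j * p' / q'
    set r := j * p' % q'
    have key : q' * ((q + j) * (p + p')) + j =
        q' * ((p + a) * (q + q')) + (r * (q + q') + q') := by
      zify at h hd ⊢
      linear_combination (-(q + q') : ℤ) * hd + (q' - j) * h
    have hr' : r * (q + q') + (q + q') ≤ q' * (q + q') := by nlinarith
    refine Nat.div_eq_of_lt_le (le_of_mul_le_mul_left (a := q') ?_ hq')
      (lt_of_mul_lt_mul_left (a := q') ?_ hq'.le)
    · omega
    · rw [add_mul (p + a), one_mul, mul_add q' ((p + a) * (q + q'))]; omega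
  rw [mechanicalWord, List.range_add, List.map_append, List.map_map]
  congr 1
  · refine List.map_congr_left fun i hi => ?_
    rw [List.mem_range] at hi
    rw [h1 i (by omega), h1 (i + 1) (by omega)]
  · refine List.map_congr_left fun j hj => ?_
    rw [List.mem_range] at hj
    simp only [Function.comp_apply]
    rw [h2 j (by omega), add_assoc, h2 (j + 1) (by omega)]
    omega

theorem mechanicalWord_one_right (p : ℕ) : mechanicalWord p 1 = [p] := by
  simp [mechanicalWord]

theorem markovXi_mul_markovXiBar : markovXi * markovXiBar = 4 := by
  have := Real.sq_sqrt (show (0 : ℝ) ≤ 5 by norm_num)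
  rw [markovXi, markovXiBar]
  linear_combination -this

theorem markovXi_add_markovXiBar : markovXi + markovXiBar = 6 := by
  rw [markovXi, markovXiBar]
  ring

/-- The matrix attached to the slope `1 / 0`; left multiplication by it adds `1` to a letter. -/
noncomputable def verticalMatrix : Matrix (Fin 2) (Fin 2) ℝ :=
  !![markovXi / 2, 0; 0, markovXiBar / 2]

theorem det_verticalMatrix : verticalMatrix.det = 1 := by
  rw [verticalMatrix, Matrix.det_fin_two_of]
  linear_combination markovXi_mul_markovXiBar / 4

theorem det_letterMatrix (n : ℕ) : (letterMatrix n).det = 1 := by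
  have h : (markovXi + 2) * (markovXiBar + 2) = 20 := by
    linear_combination markovXi_mul_markovXiBar + 2 * markovXi_add_markovXiBar
  have h' : markovXi ^ n * markovXiBar ^ n = 2 ^ n * 2 ^ n := by
    rw [← mul_pow, ← mul_pow, markovXi_mul_markovXiBar]
    norm_num
  rw [Matrix.det_fin_two]
  simp only [letterMatrix, Matrix.of_apply]
  simp
  field_simp
  linear_combination 5 * markovXi ^ n * markovXiBar ^ n * h + 100 * h'

theorem letterMatrix_succ (n : ℕ) : letterMatrix (n + 1) = verticalMatrix * letterMatrix n := by
  ext i j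
  fin_cases i <;> fin_cases j <;>
    simp [letterMatrix, verticalMatrix, Matrix.mul_apply, Fin.sum_univ_two, pow_succ] <;>
    field_simp

theorem letterMatrix_eq_pow_mul (n : ℕ) :
    letterMatrix n = verticalMatrix ^ n * letterMatrix 0 := by
  induction n with
  | zero => simp
  | succ n ih => rw [letterMatrix_succ, ih, pow_succ', mul_assoc]

theorem trace_letterMatrix_one : (letterMatrix 1).trace = 6 := by
  rw [Matrix.trace_fin_two]
  simp only [letterMatrix, Matrix.of_apply]
  simp
  linear_combination 3 / 20 * ((markovXi + markovXiBar + 8) * markovXi_add_markovXiBar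
    - 2 * markovXi_mul_markovXiBar)

theorem trace_letterMatrix_two : (letterMatrix 2).trace = 15 := by
  rw [Matrix.trace_fin_two]
  simp only [letterMatrix, Matrix.of_apply]
  simp
  have hs := markovXi_add_markovXiBar
  have hb : markovXiBar = 6 - markovXi := by linarith
  have hp := markovXi_mul_markovXiBar
  rw [hb] at hp ⊢
  linear_combination -33 / 20 * hp

/-- The matrix of the slope `p / q`. For `q = 0` the matrix of `1 / 0` is conjugated so that it
can be appended on the right of a word, where new letters are concatenated. -/
noncomputable def slopeMatrix (p q : ℕ) : Matrix (Fin 2) (Fin 2) ℝ :=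
  if q = 0 then (letterMatrix 0)⁻¹ * verticalMatrix * letterMatrix 0
  else ((mechanicalWord p q).map letterMatrix).prod

theorem slopeMatrix_mediant {p q p' q' : ℕ} (hq : 0 < q) (h : p' * q = p * q' + 1) :
    slopeMatrix (p + p') (q + q') = slopeMatrix p q * slopeMatrix p' q' := by
  rcases Nat.eq_zero_or_pos q' with rfl | hq'
  · obtain ⟨rfl, rfl⟩ : p' = 1 ∧ q = 1 := by simpa using h
    have hu : IsUnit (letterMatrix 0).det := by simp [det_letterMatrix]
    simp only [slopeMatrix, add_zero, one_ne_zero, if_false, if_true, mechanicalWord_one_right,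
      List.map_cons, List.map_nil, List.prod_singleton]
    rw [letterMatrix_eq_pow_mul p, letterMatrix_eq_pow_mul (p + 1), mul_assoc, mul_assoc,
      Matrix.mul_nonsing_inv_cancel_left _ _ hu, pow_succ, mul_assoc]
  · rw [slopeMatrix, slopeMatrix, slopeMatrix, if_neg (by omega), if_neg (by omega),
      if_neg (by omega), mechanicalWord_mediant hq hq' h, List.map_append, List.prod_append]

theorem det_slopeMatrix (p q : ℕ) : (slopeMatrix p q).det = 1 := by
  unfold slopeMatrix
  split_ifs
  · rw [Matrix.det_mul, Matrix.det_mul, Matrix.det_nonsing_inv, det_letterMatrix,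
      det_verticalMatrix]
    simp
  · induction mechanicalWord p q with
    | nil => simp
    | cons n l ih => simp [det_letterMatrix, ih]

theorem Matrix.trace_mul_mul_self_left {R : Type*} [CommRing R] (X Y : Matrix (Fin 2) (Fin 2) R) :
    (X * (X * Y)).trace = X.trace * (X * Y).trace - X.det * Y.trace := by
  simp only [Matrix.trace_fin_two, Matrix.det_fin_two, Matrix.mul_apply, Fin.sum_univ_two]
  ring

theorem Matrix.trace_mul_mul_self_right {R : Type*} [CommRing R] (X Y : Matrix (Fin 2) (Fin 2) R) :
    (X * Y * Y).trace = (X * Y).trace * Y.trace - Y.det * X.trace := by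
  simp only [Matrix.trace_fin_two, Matrix.det_fin_two, Matrix.mul_apply, Fin.sum_univ_two]
  ring

theorem necklacePhi_mechanicalWord (p : ℕ) {q : ℕ} (hq : 0 < q) :
    necklacePhi (mechanicalWord p q : List ℕ) = (slopeMatrix p q).trace / 3 := by
  change phiSeq (mechanicalWord p q).get = _
  rw [phiSeq_eq_trace (by simp; omega), slopeMatrix, if_neg (by omega)]
  congr 3
  conv_rhs => rw [← List.ofFn_get (mechanicalWord p q), List.map_ofFn]
  rfl

/-! ### The Stern–Brocot tree above `1` -/

/-- The interval of Farey neighbours at a node of the Stern–Brocot tree with root `(1 / 1, 1 / 0)`.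
A fraction `p / q` is encoded as `(p, q)`; the head of the list is the last step, `false` standing
for the left half and `true` for the right half. -/
def fareyInterval : List Bool → (ℕ × ℕ) × (ℕ × ℕ)
  | [] => ((1, 1), (1, 0))
  | false :: w => ((fareyInterval w).1, (fareyInterval w).1 + (fareyInterval w).2)
  | true :: w => ((fareyInterval w).1 + (fareyInterval w).2, (fareyInterval w).2)

/-- The mediant of the Farey interval at a node. -/
def fareyMediant (w : List Bool) : ℕ × ℕ := (fareyInterval w).1 + (fareyInterval w).2

/-- Farey neighbours `p / q < p' / q'` with `1 ≤ p / q`. -/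
def IsFareyInterval (I : (ℕ × ℕ) × (ℕ × ℕ)) : Prop :=
  I.2.1 * I.1.2 = I.1.1 * I.2.2 + 1 ∧ 0 < I.1.2 ∧ I.1.2 ≤ I.1.1

theorem isFareyInterval_fareyInterval (w : List Bool) : IsFareyInterval (fareyInterval w) := by
  induction w with
  | nil => simp [IsFareyInterval, fareyInterval]
  | cons b w ih =>
    obtain ⟨h1, h2, h3⟩ := ih
    have h4 : (fareyInterval w).2.2 ≤ (fareyInterval w).2.1 := by nlinarith
    cases b <;> simp only [IsFareyInterval, fareyInterval, Prod.fst_add, Prod.snd_add]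
    · exact ⟨by linarith, h2, h3⟩
    · exact ⟨by linarith, by omega, by omega⟩

theorem exists_fareyInterval_eq (n : ℕ) : ∀ p q p' q' : ℕ, p + p' ≤ n →
    IsFareyInterval ((p, q), (p', q')) → ∃ w, fareyInterval w = ((p, q), (p', q')) := by
  induction n with
  | zero =>
    rintro p q p' q' hn ⟨-, h2, h3⟩
    simp only at h2 h3
    omega
  | succ n ih =>
    rintro p q p' q' hn ⟨h1, h2, h3⟩
    simp only at h1 h2 h3
    have hp' : 0 < p' := Nat.pos_of_ne_zero fun h => by simp [h] at h1
    rcases lt_trichotomy p p' with hlt | rfl | hlt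
    · have hqq : q ≤ q' := by by_contra hc; nlinarith
      obtain ⟨d, rfl⟩ := Nat.exists_eq_add_of_le hlt.le
      obtain ⟨e, rfl⟩ := Nat.exists_eq_add_of_le hqq
      obtain ⟨w, hw⟩ := ih p q d e (by omega) ⟨by simp only; linarith, h2, h3⟩
      exact ⟨false :: w, by simp [fareyInterval, hw]⟩
    · have hqq : q' < q := by by_contra hc; nlinarith
      obtain ⟨e, rfl⟩ := Nat.exists_eq_add_of_lt hqq
      have : p * (e + 1) = 1 := by linarith
      obtain ⟨rfl, he⟩ := mul_eq_one.1 this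
      obtain rfl : e = 0 := by omega
      obtain rfl : q' = 0 := by omega
      exact ⟨[], rfl⟩
    · have hqq : q' < q := by by_contra hc; nlinarith
      obtain ⟨d, rfl⟩ := Nat.exists_eq_add_of_lt hlt
      obtain ⟨e, rfl⟩ := Nat.exists_eq_add_of_lt hqq
      have hdet : p' * (e + 1) = (d + 1) * q' + 1 := by linarith
      have hle : e + 1 ≤ d + 1 := by
        by_contra hc
        -- Otherwise `(d + 1) / (e + 1) < 1 < p' / q'`, and the determinant is at least
        -- `(q' + 1) (e + 1) - e q' = e + 1 + q' > 1`.
        have h5 : d + 1 ≤ e := by omega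
        have h6 : q' + 1 ≤ p' := by omega
        have : (q' + 1) * (e + 1) ≤ p' * (e + 1) := Nat.mul_le_mul_right _ h6
        have : (d + 1) * q' ≤ e * q' := Nat.mul_le_mul_right _ h5
        nlinarith
      obtain ⟨w, hw⟩ := ih (d + 1) (e + 1) p' q' (by omega) ⟨hdet, by simp, hle⟩
      refine ⟨true :: w, ?_⟩
      simp [fareyInterval, hw]
      omega

theorem fareyInterval_injective : Function.Injective fareyInterval := by
  have hpos : ∀ w, 0 < (fareyInterval w).1.1 ∧ 0 < (fareyInterval w).2.1 := by
    intro w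
    obtain ⟨h1, h2, h3⟩ := isFareyInterval_fareyInterval w
    exact ⟨by omega, Nat.pos_of_ne_zero fun h => by simp [h] at h1⟩
  intro w
  induction w with
  | nil =>
    intro w' h
    cases w' with
    | nil => rfl
    | cons b w' =>
      have := hpos w'
      cases b <;> simp [fareyInterval, Prod.ext_iff] at h <;> omega
  | cons b w ih =>
    intro w' h
    have := hpos w
    cases w' with
    | nil => cases b <;> simp [fareyInterval, Prod.ext_iff] at h <;> omega
    | cons b' w' =>
      have := hpos w'
      have e : fareyInterval w = fareyInterval w' → b = b' → b :: w = b' :: w' := by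
        intro h1 h2
        rw [ih h1, h2]
      cases b <;> cases b' <;> simp only [fareyInterval, Prod.ext_iff, Prod.fst_add,
        Prod.snd_add] at h e
      · exact e (by omega) trivial
      · omega
      · omega
      · exact e (by omega) trivial

/-- Farey neighbours are determined by their mediant. -/
theorem fareyMediant_injective : Function.Injective fareyMediant := by
  intro w w' h
  apply fareyInterval_injective
  obtain ⟨h1, h2, h3⟩ := isFareyInterval_fareyInterval w
  obtain ⟨h1', h2', h3'⟩ := isFareyInterval_fareyInterval w'
  simp only [fareyMediant] at h
  generalize fareyInterval w = I at *
  generalize fareyInterval w' = J at *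
  obtain ⟨⟨p, q⟩, ⟨p', q'⟩⟩ := I
  obtain ⟨⟨a, b⟩, ⟨a', b'⟩⟩ := J
  simp only [Prod.mk_add_mk, Prod.mk.injEq] at *
  obtain ⟨hr, hs⟩ := h
  have hcop : IsCoprime ((q + q' : ℕ) : ℤ) ((p + p' : ℕ) : ℤ) :=
    ⟨-p, q, by push_cast; zify at h1; linear_combination h1⟩
  have heq : ((p + p' : ℕ) : ℤ) * (q - b) = ((q + q' : ℕ) : ℤ) * (p - a) := by
    zify at h1 h1' hr hs
    push_cast
    linear_combination h1 - h1' - b * hr + a * hs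
  have hdvd : ((q + q' : ℕ) : ℤ) ∣ (q - b : ℤ) := hcop.dvd_of_dvd_mul_left ⟨_, heq⟩
  have hqb : (q - b : ℤ) = 0 := by
    refine Int.eq_zero_of_abs_lt_dvd hdvd ?_
    rw [abs_lt]; push_cast; omega
  rw [hqb, mul_zero, eq_comm, mul_eq_zero] at heq
  have : (p : ℤ) - a = 0 := heq.resolve_left (by push_cast; omega)
  omega

theorem exists_fareyMediant_eq {r s : ℕ} (hs : 0 < s) (hsr : s < r) (h : r.Coprime s) :
    ∃ w, fareyMediant w = (r, s) := by
  -- `q` is the inverse of `r` modulo `s` in `{1, …, s}`.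
  obtain ⟨q, hq0, hqs, p, hp⟩ : ∃ q, 0 < q ∧ q ≤ s ∧ ∃ p, r * q = p * s + 1 := by
    rcases Nat.eq_or_lt_of_le (Nat.one_le_iff_ne_zero.2 hs.ne') with rfl | hs1
    · exact ⟨1, one_pos, le_rfl, r - 1, by omega⟩
    · obtain ⟨q, hq, hq'⟩ := Nat.exists_mul_mod_eq_one_of_coprime h hs1
      refine ⟨q, Nat.pos_of_ne_zero fun h0 => ?_, hq.le, r * q / s, ?_⟩
      · simp [h0] at hq'
      · have := Nat.div_add_mod (r * q) s
        rw [hq'] at this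
        linarith
  have hqp : q ≤ p := by by_contra hc; nlinarith
  have hpr : p ≤ r := by by_contra hc; nlinarith
  obtain ⟨p', rfl⟩ := Nat.exists_eq_add_of_le hpr
  obtain ⟨q', rfl⟩ := Nat.exists_eq_add_of_le hqs
  obtain ⟨w, hw⟩ := exists_fareyInterval_eq _ p q p' q' le_rfl
    ⟨by simp only; linarith, hq0, hqp⟩
  exact ⟨w, by simp [fareyMediant, hw]⟩

/-! ### The tree of Markov triples -/

/-- The Markov triple `(x, y, z)` at a node of the tree with root `(2, 1, 5)`; `z` is its largest
element. The nodes are encoded as for `fareyInterval`. -/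
def markovTriple : List Bool → ℕ × ℕ × ℕ
  | [] => (2, 1, 5)
  | false :: w => ((markovTriple w).1, (markovTriple w).2.2,
      3 * (markovTriple w).1 * (markovTriple w).2.2 - (markovTriple w).2.1)
  | true :: w => ((markovTriple w).2.2, (markovTriple w).2.1,
      3 * (markovTriple w).2.2 * (markovTriple w).2.1 - (markovTriple w).1)

theorem IsMarkovTriple.swap {x y z : ℕ} (h : IsMarkovTriple x y z) : IsMarkovTriple y x z :=
  ⟨h.2.1, h.1, h.2.2.1, by linarith [h.2.2.2]⟩

theorem IsMarkovTriple.mutate {x y z t : ℕ} (h : IsMarkovTriple x y z) (ht : t + y = 3 * x * z)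
    (ht0 : 0 < t) : IsMarkovTriple x z t := by
  obtain ⟨hx, hy, hz, h⟩ := h
  refine ⟨hx, hz, ht0, ?_⟩
  zify at h ht ⊢
  linear_combination h + (t - y) * ht

/-- The invariants of the nodes of the tree. The condition `x ≠ y` separates the two children of a
node. -/
theorem markovTriple_spec (w : List Bool) :
    IsMarkovTriple (markovTriple w).1 (markovTriple w).2.1 (markovTriple w).2.2 ∧
      (markovTriple w).1 < (markovTriple w).2.2 ∧ (markovTriple w).2.1 < (markovTriple w).2.2 ∧
      (markovTriple w).1 ≠ (markovTriple w).2.1 := by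
  have key : ∀ {x y z t : ℕ}, IsMarkovTriple x y z → x < z → y < z → t + y = 3 * x * z →
      IsMarkovTriple x z t ∧ x < t ∧ z < t := by
    intro x y z t h hx hy ht
    have hzt : z < t := by nlinarith [h.1]
    exact ⟨h.mutate ht (by omega), by omega, hzt⟩
  induction w with
  | nil => simp [markovTriple, IsMarkovTriple]
  | cons b w ih =>
    obtain ⟨h, hx, hy, hxy⟩ := ih
    cases b <;> simp only [markovTriple]
    · have hle : (markovTriple w).2.1 ≤ 3 * (markovTriple w).1 * (markovTriple w).2.2 := by
        nlinarith [h.1]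
      obtain ⟨h1, h2, h3⟩ := key h hx hy (Nat.sub_add_cancel hle)
      exact ⟨h1, h2, h3, by omega⟩
    · have hle : (markovTriple w).1 ≤ 3 * (markovTriple w).2.2 * (markovTriple w).2.1 := by
        nlinarith [h.2.1]
      obtain ⟨h1, h2, h3⟩ := key h.swap hy hx
        ((Nat.sub_add_cancel hle).trans (by ring))
      exact ⟨h1.swap, h3, h2, by omega⟩

theorem markovTriple_false_add (w : List Bool) : (markovTriple (false :: w)).2.2 +
    (markovTriple w).2.1 = 3 * (markovTriple w).1 * (markovTriple w).2.2 := by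
  obtain ⟨h, hx, hy, -⟩ := markovTriple_spec w
  exact Nat.sub_add_cancel (by nlinarith [h.1])

theorem markovTriple_true_add (w : List Bool) : (markovTriple (true :: w)).2.2 +
    (markovTriple w).1 = 3 * (markovTriple w).2.2 * (markovTriple w).2.1 := by
  obtain ⟨h, hx, hy, -⟩ := markovTriple_spec w
  exact Nat.sub_add_cancel (by nlinarith [h.2.1])

theorem five_le_markovTriple (w : List Bool) : 5 ≤ (markovTriple w).2.2 := by
  induction w with
  | nil => simp [markovTriple]
  | cons b w ih =>
    obtain ⟨-, h1, h2, -⟩ := markovTriple_spec (b :: w)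
    cases b <;> simp only [markovTriple] at h1 h2 ⊢ <;> omega

/-- The other root of the Markov equation in its largest variable is smaller than the middle
element. -/
theorem IsMarkovTriple.exists_descent {x y z : ℕ} (h : IsMarkovTriple x y z) (hxy : x ≤ y)
    (hyz : y ≤ z) (hz : 2 < z) :
    ∃ t, t + z = 3 * x * y ∧ t ≤ y ∧ y < z ∧ IsMarkovTriple x t y := by
  obtain ⟨hx, hy, hz0, h⟩ := h
  have h1 : z ≤ 3 * x * y := by
    by_contra hc
    nlinarith
  obtain ⟨t, ht⟩ := Nat.exists_eq_add_of_le h1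
  have ht' : t + z = 3 * x * y := by omega
  have ht0 : 0 < t := by
    refine Nat.pos_of_ne_zero fun h0 => ?_
    rw [h0, zero_add] at ht'
    nlinarith
  have hprod : (z - y : ℤ) * (y - t) = (3 * x - 2) * y ^ 2 - x ^ 2 := by
    zify at h ht'
    linear_combination h - (z - y) * ht'
  have hy1 : y ≠ 1 := by
    rintro rfl
    obtain rfl : x = 1 := by omega
    nlinarith
  have hpos : (0 : ℤ) < (3 * x - 2) * y ^ 2 - x ^ 2 := by
    have hx' : (1 : ℤ) ≤ x := by exact_mod_cast hx
    have hxy' : (x : ℤ) ≤ y := by exact_mod_cast hxy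
    have hy' : (2 : ℤ) ≤ y := by omega
    rcases hx'.eq_or_lt with h2 | h2
    · rw [← h2]; nlinarith
    · nlinarith
  rw [← hprod] at hpos
  have hzy : (0 : ℤ) ≤ z - y := by omega
  have h2 : (0 : ℤ) < z - y := hzy.lt_of_ne fun h0 => by simp [← h0] at hpos
  have h3 := (mul_pos_iff_of_pos_left h2).1 hpos
  refine ⟨t, ht', by omega, by omega, hx, ht0, hy, ?_⟩
  zify at h ht' ⊢
  linear_combination h + (t - z) * ht'

theorem isMarkovTriple_of_le_four {x y z : ℕ} (h : IsMarkovTriple x y z) (hxz : x ≤ z)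
    (hyz : y ≤ z) (hz : z ≤ 4) : (x = 1 ∧ y = 1) ∧ (z = 1 ∨ z = 2) := by
  obtain ⟨hx, hy, hz0, h⟩ := h
  have hx4 : x ≤ 4 := hxz.trans hz
  have hy4 : y ≤ 4 := hyz.trans hz
  interval_cases z <;> interval_cases x <;> interval_cases y <;> simp_all

/-- Up to exchanging `x` and `y`, every Markov triple with largest element at least `5` occurs in
the tree. -/
theorem exists_markovTriple_eq (n : ℕ) : ∀ x y z : ℕ, z ≤ n → IsMarkovTriple x y z → x ≤ y →
    y ≤ z → 5 ≤ z → ∃ w, markovTriple w = (x, y, z) ∨ markovTriple w = (y, x, z) := by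
  induction n with
  | zero => intro x y z hn _ _ _ h5; omega
  | succ n ih =>
    intro x y z hn h hxy hyz h5
    obtain ⟨t, ht, hty, hlt, ht'⟩ := h.exists_descent hxy hyz (by omega)
    rcases Nat.lt_or_ge y 5 with hy | hy
    · obtain ⟨⟨rfl, rfl⟩, rfl | rfl⟩ := isMarkovTriple_of_le_four ht' hxy hty (by omega)
      · omega
      · obtain rfl : z = 5 := by omega
        exact ⟨[], Or.inr rfl⟩
    · have hex : ∃ w, markovTriple w = (x, t, y) ∨ markovTriple w = (t, x, y) := by
        rcases le_total x t with hxt | hxt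
        · exact ih x t y (by omega) ht' hxt hty hy
        · obtain ⟨w, hw⟩ := ih t x y (by omega) ht'.swap hxt hxy hy
          exact ⟨w, hw.symm⟩
      obtain ⟨w, hw | hw⟩ := hex
      · refine ⟨false :: w, Or.inl ?_⟩
        simp only [markovTriple, hw, Prod.mk.injEq, true_and]
        omega
      · refine ⟨true :: w, Or.inr ?_⟩
        simp only [markovTriple, hw, Prod.mk.injEq, true_and]
        rw [mul_right_comm]
        omega

/-- A node of the tree is determined by its triple, up to exchanging `x` and `y`. -/
theorem eq_of_markovTriple_eq (w w' : List Bool)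
    (h : markovTriple w = markovTriple w' ∨
      markovTriple w = ((markovTriple w').2.1, (markovTriple w').1, (markovTriple w').2.2)) :
    w = w' := by
  have hroot : ∀ b w, (markovTriple (b :: w)).2.2 ≠ 5 := by
    intro b w
    have := five_le_markovTriple w
    obtain ⟨-, h1, h2, -⟩ := markovTriple_spec (b :: w)
    cases b <;> simp only [markovTriple] at h1 h2 ⊢ <;> omega
  have hz : (markovTriple w).2.2 = (markovTriple w').2.2 := by
    rcases h with h | h <;> rw [h]
  induction w generalizing w' with
  | nil =>
    cases w' with
    | nil => rfl
    | cons b' w' => exact absurd hz.symm (hroot b' w')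
  | cons b w ih =>
    cases w' with
    | nil => exact absurd hz (hroot b w)
    | cons b' w' =>
      obtain ⟨-, hx, hy, hxy⟩ := markovTriple_spec w
      obtain ⟨-, hx', hy', hxy'⟩ := markovTriple_spec w'
      have hf := markovTriple_false_add w
      have ht := markovTriple_true_add w
      have hf' := markovTriple_false_add w'
      have ht' := markovTriple_true_add w'
      have e : (markovTriple w).2.2 = (markovTriple w').2.2 →
          ((markovTriple w).1 = (markovTriple w').1 ∧
            (markovTriple w).2.1 = (markovTriple w').2.1 ∨
          (markovTriple w).1 = (markovTriple w').2.1 ∧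
            (markovTriple w).2.1 = (markovTriple w').1) → w = w' := by
        intro h1 h2
        exact ih w' (by simp only [Prod.ext_iff]; tauto) h1
      -- The parent's largest element is the larger of the first two elements of its child.
      cases b <;> cases b' <;> simp only [markovTriple, Prod.ext_iff] at h <;> clear ih
      · have h1 : (markovTriple w).1 = (markovTriple w').1 := by omega
        have h2 : (markovTriple w).2.2 = (markovTriple w').2.2 := by omega
        rw [h1, h2] at hf
        rw [e h2 (Or.inl ⟨h1, by omega⟩)]
      · have h1 : (markovTriple w).1 = (markovTriple w').2.1 := by omega
        have h2 : (markovTriple w).2.2 = (markovTriple w').2.2 := by omega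
        rw [h1, h2, mul_right_comm] at hf
        obtain rfl := e h2 (Or.inr ⟨h1, by omega⟩)
        exact absurd h1 hxy
      · have h1 : (markovTriple w).2.1 = (markovTriple w').1 := by omega
        have h2 : (markovTriple w).2.2 = (markovTriple w').2.2 := by omega
        rw [h1, h2, mul_right_comm] at ht
        obtain rfl := e h2 (Or.inr ⟨by omega, h1⟩)
        exact absurd h1.symm hxy
      · have h1 : (markovTriple w).2.1 = (markovTriple w').2.1 := by omega
        have h2 : (markovTriple w).2.2 = (markovTriple w').2.2 := by omega
        rw [h1, h2] at ht
        rw [e h2 (Or.inl ⟨by omega, h1⟩)]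

/-! ### Values at the nodes -/

/-- The traces of the matrices of a Farey interval and of its mediant are three times the
corresponding Markov triple. -/
theorem trace_slopeMatrix (w : List Bool) :
    (slopeMatrix (fareyInterval w).1.1 (fareyInterval w).1.2).trace = 3 * (markovTriple w).1 ∧
    (slopeMatrix (fareyInterval w).2.1 (fareyInterval w).2.2).trace = 3 * (markovTriple w).2.1 ∧
    (slopeMatrix (fareyMediant w).1 (fareyMediant w).2).trace = 3 * (markovTriple w).2.2 := by
  induction w with
  | nil =>
    simp only [fareyMediant, fareyInterval, markovTriple, Prod.mk_add_mk, slopeMatrix,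
      mechanicalWord_one_right]
    refine ⟨?_, ?_, ?_⟩
    · simp [trace_letterMatrix_one]; norm_num
    · have hu : IsUnit (letterMatrix 0).det := by simp [det_letterMatrix]
      rw [if_pos trivial, mul_assoc, Matrix.trace_mul_comm, mul_assoc, Matrix.mul_nonsing_inv _ hu,
        mul_one, verticalMatrix, Matrix.trace_fin_two_of]
      push_cast
      linear_combination markovXi_add_markovXiBar / 2
    · simp [mechanicalWord_one_right, trace_letterMatrix_two]; norm_num
  | cons b w ih =>
    obtain ⟨h1, h2, h3⟩ := ih
    have hI := isFareyInterval_fareyInterval w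
    have hJ := isFareyInterval_fareyInterval (b :: w)
    have hmed := slopeMatrix_mediant hI.2.1 hI.1
    have hmed' := slopeMatrix_mediant hJ.2.1 hJ.1
    have hadd := markovTriple_false_add w
    have hadd' := markovTriple_true_add w
    have hM : slopeMatrix (fareyMediant w).1 (fareyMediant w).2 = _ := hmed
    rw [hM] at h3
    cases b
    · refine ⟨h1, (congrArg Matrix.trace hmed).trans h3, ?_⟩
      have e : slopeMatrix (fareyMediant (false :: w)).1 (fareyMediant (false :: w)).2 =
        slopeMatrix (fareyInterval w).1.1 (fareyInterval w).1.2 *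
          slopeMatrix (fareyMediant w).1 (fareyMediant w).2 := hmed'
      rw [e, hM, Matrix.trace_mul_mul_self_left, det_slopeMatrix, h1, h2, h3]
      have := congrArg (Nat.cast : ℕ → ℝ) hadd
      push_cast at this
      linear_combination -3 * this
    · refine ⟨(congrArg Matrix.trace hmed).trans h3, h2, ?_⟩
      have e : slopeMatrix (fareyMediant (true :: w)).1 (fareyMediant (true :: w)).2 =
        slopeMatrix (fareyMediant w).1 (fareyMediant w).2 *
          slopeMatrix (fareyInterval w).2.1 (fareyInterval w).2.2 := hmed'
      rw [e, hM, Matrix.trace_mul_mul_self_right, det_slopeMatrix, h1, h2, h3]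
      have := congrArg (Nat.cast : ℕ → ℝ) hadd'
      push_cast at this
      linear_combination -3 * this

/-- The necklace of the mediant at a node. -/
def nodeNecklace (w : List Bool) : Cycle ℕ :=
  (mechanicalWord (fareyMediant w).1 (fareyMediant w).2 : List ℕ)

theorem fareyMediant_snd_pos (w : List Bool) : 0 < (fareyMediant w).2 :=
  Nat.add_pos_left (isFareyInterval_fareyInterval w).2.1 _

theorem necklacePhi_nodeNecklace (w : List Bool) :
    necklacePhi (nodeNecklace w) = (markovTriple w).2.2 := by
  rw [nodeNecklace, necklacePhi_mechanicalWord _ (fareyMediant_snd_pos w),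
    (trace_slopeMatrix w).2.2]
  ring

theorem nodeNecklace_injective : Function.Injective nodeNecklace := by
  intro w w' h
  obtain ⟨h1, h2⟩ := cycle_length_eq h
  rw [mechanicalWord_sum _ (fareyMediant_snd_pos w),
    mechanicalWord_sum _ (fareyMediant_snd_pos w')] at h2
  simp only [mechanicalWord_length] at h1
  exact fareyMediant_injective (Prod.ext h2 h1)

theorem mem_smallVariationNecklaces_iff_node (c : Cycle ℕ) :
    c ∈ smallVariationNecklaces ↔ c = (([0] : List ℕ) : Cycle ℕ) ∨
      c = (([1] : List ℕ) : Cycle ℕ) ∨ ∃ w, c = nodeNecklace w := by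
  rw [mem_smallVariationNecklaces_iff]
  refine or_congr Iff.rfl ⟨?_, ?_⟩
  · rintro ⟨p, q, hq, hqp, hcop, rfl⟩
    rcases hqp.eq_or_lt with rfl | hlt
    · obtain rfl : q = 1 := by simpa using hcop
      exact Or.inl (by rw [mechanicalWord_one_right])
    · obtain ⟨w, hw⟩ := exists_fareyMediant_eq hq hlt hcop
      exact Or.inr ⟨w, by rw [nodeNecklace, hw]⟩
  · rintro (rfl | ⟨w, rfl⟩)
    · exact ⟨1, 1, one_pos, le_rfl, by simp, by rw [mechanicalWord_one_right]⟩
    · obtain ⟨h1, h2, h3⟩ := isFareyInterval_fareyInterval w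
      have h4 : (fareyInterval w).2.2 ≤ (fareyInterval w).2.1 := by nlinarith
      refine ⟨_, _, fareyMediant_snd_pos w, add_le_add h3 h4, ?_, rfl⟩
      rw [← Nat.isCoprime_iff_coprime]
      refine ⟨(fareyInterval w).1.2, -(fareyInterval w).1.1, ?_⟩
      simp only [fareyMediant, Prod.snd_add]
      push_cast
      zify at h1
      linear_combination h1

theorem necklacePhi_zero : necklacePhi (([0] : List ℕ) : Cycle ℕ) = 1 := by
  rw [← show mechanicalWord 0 1 = [0] from mechanicalWord_one_right 0,
    necklacePhi_mechanicalWord 0 one_pos, slopeMatrix, if_neg one_ne_zero,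
    mechanicalWord_one_right]
  have := markovXi_add_markovXiBar
  simp [Matrix.trace_fin_two, letterMatrix]
  linear_combination this / 10

theorem necklacePhi_one : necklacePhi (([1] : List ℕ) : Cycle ℕ) = 2 := by
  rw [← mechanicalWord_one_right 1, necklacePhi_mechanicalWord 1 one_pos, slopeMatrix,
    if_neg one_ne_zero, mechanicalWord_one_right]
  simp [trace_letterMatrix_one]
  norm_num

/-- Every Markov triple other than `(1, 1, 1)` and `(1, 1, 2)` comes from a node. -/
theorem IsMarkovTriple.cases_node {x y z : ℕ} (h : IsMarkovTriple x y z) (hxy : x ≤ y)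
    (hyz : y ≤ z) : ((x = 1 ∧ y = 1) ∧ (z = 1 ∨ z = 2)) ∨
      ∃ w, markovTriple w = (x, y, z) ∨ markovTriple w = (y, x, z) := by
  rcases Nat.lt_or_ge z 5 with h5 | h5
  · exact Or.inl (isMarkovTriple_of_le_four h (hxy.trans hyz) hyz (by omega))
  · exact Or.inr (exists_markovTriple_eq z x y z le_rfl h hxy hyz h5)

theorem necklacePhi_image : necklacePhi '' smallVariationNecklaces =
    (fun m : ℕ => (m : ℝ)) '' {m : ℕ | IsMarkovNumber m} := by
  ext r
  constructor
  · rintro ⟨c, hc, rfl⟩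
    rcases (mem_smallVariationNecklaces_iff_node c).1 hc with rfl | rfl | ⟨w, rfl⟩
    · exact ⟨1, ⟨1, 1, by norm_num [IsMarkovTriple]⟩, by simp [necklacePhi_zero]⟩
    · exact ⟨2, ⟨1, 1, by norm_num [IsMarkovTriple]⟩, by simp [necklacePhi_one]⟩
    · obtain ⟨h, hx, hy, -⟩ := markovTriple_spec w
      exact ⟨_, ⟨_, _, h, hx.le, hy.le⟩, (necklacePhi_nodeNecklace w).symm⟩
  · rintro ⟨z, ⟨x, y, h, hx, hy⟩, rfl⟩
    wlog hxy : x ≤ y generalizing x y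
    · exact this y x h.swap hy hx (le_of_not_ge hxy)
    rcases h.cases_node hxy hy with ⟨-, rfl | rfl⟩ | ⟨w, hw⟩
    · exact ⟨_, (mem_smallVariationNecklaces_iff_node _).2 (Or.inl rfl), by
        simp [necklacePhi_zero]⟩
    · exact ⟨_, (mem_smallVariationNecklaces_iff_node _).2 (Or.inr (Or.inl rfl)), by
        simp [necklacePhi_one]⟩
    · refine ⟨nodeNecklace w, (mem_smallVariationNecklaces_iff_node _).2
        (Or.inr (Or.inr ⟨w, rfl⟩)), ?_⟩
      rw [necklacePhi_nodeNecklace]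
      rcases hw with hw | hw <;> simp [hw]

/-- Both the uniqueness conjecture and the injectivity of `Φ` say that the largest elements of the
triples in the tree are pairwise distinct. -/
theorem injOn_necklacePhi_iff : Set.InjOn necklacePhi smallVariationNecklaces ↔
    Function.Injective fun w => (markovTriple w).2.2 := by
  constructor
  · intro h w w' hw
    have hmem : ∀ w, nodeNecklace w ∈ smallVariationNecklaces := fun w =>
      (mem_smallVariationNecklaces_iff_node _).2 (Or.inr (Or.inr ⟨w, rfl⟩))
    refine nodeNecklace_injective (h (hmem w) (hmem w') ?_)
    rw [necklacePhi_nodeNecklace, necklacePhi_nodeNecklace]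
    exact congrArg Nat.cast hw
  · intro h c hc c' hc' hcc
    have h5 : ∀ w, (5 : ℝ) ≤ (markovTriple w).2.2 := fun w => by
      exact_mod_cast five_le_markovTriple w
    rw [mem_smallVariationNecklaces_iff_node] at hc hc'
    rcases hc with rfl | rfl | ⟨w, rfl⟩ <;> rcases hc' with rfl | rfl | ⟨w', rfl⟩ <;>
      simp only [necklacePhi_zero, necklacePhi_one, necklacePhi_nodeNecklace] at hcc
    · rfl
    · norm_num at hcc
    · linarith [h5 w']
    · norm_num at hcc
    · rfl
    · linarith [h5 w']
    · linarith [h5 w]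
    · linarith [h5 w]
    · rw [h (Nat.cast_injective hcc)]

theorem markovUniquenessConjecture_iff : MarkovUniquenessConjecture ↔
    Function.Injective fun w => (markovTriple w).2.2 := by
  constructor
  · intro h w w' hw
    simp only at hw
    apply eq_of_markovTriple_eq
    obtain ⟨hm, hx, hy, -⟩ := markovTriple_spec w
    obtain ⟨hm', hx', hy', -⟩ := markovTriple_spec w'
    generalize markovTriple w = T at *
    generalize markovTriple w' = T' at *
    obtain ⟨x, y, z⟩ := T
    obtain ⟨x', y', z'⟩ := T'
    simp only [Prod.mk.injEq] at *
    subst hw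
    rcases le_total x y with h1 | h1 <;> rcases le_total x' y' with h2 | h2
    · have := h _ _ _ _ _ hm h1 hy.le hm' h2 hy'.le; tauto
    · have := h _ _ _ _ _ hm h1 hy.le hm'.swap h2 hx'.le; tauto
    · have := h _ _ _ _ _ hm.swap h1 hx.le hm' h2 hy'.le; tauto
    · have := h _ _ _ _ _ hm.swap h1 hx.le hm'.swap h2 hx'.le; tauto
  · intro h x y x' y' z hm hxy hyz hm' hxy' hyz'
    rcases hm.cases_node hxy hyz with ⟨⟨rfl, rfl⟩, hz⟩ | ⟨w, hw⟩ <;>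
      rcases hm'.cases_node hxy' hyz' with ⟨⟨rfl, rfl⟩, hz'⟩ | ⟨w', hw'⟩
    · exact ⟨rfl, rfl⟩
    · have := five_le_markovTriple w'
      rcases hw' with hw' | hw' <;> simp only [hw'] at this <;> omega
    · have := five_le_markovTriple w
      rcases hw with hw | hw <;> simp only [hw] at this <;> omega
    · obtain rfl : w = w' := h (by rcases hw with e | e <;> rcases hw' with e' | e' <;> simp [e, e'])
      rcases hw with e | e <;> rw [e] at hw' <;> simp only [Prod.mk.injEq] at hw' <;> omega

theorem theorem1 :
    (MarkovUniquenessConjecture ↔ Set.InjOn necklacePhi smallVariationNecklaces) ∧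
      necklacePhi '' smallVariationNecklaces =
        (fun m : ℕ => (m : ℝ)) '' {m : ℕ | IsMarkovNumber m} :=
  ⟨markovUniquenessConjecture_iff.trans injOn_necklacePhi_iff.symm, necklacePhi_image⟩
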